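/- \textbf{Setting.} Let $U_1,\dots,U_k$ be timed-automaton templates with conjunctive guards. Template $U_l$ has a finite set $S_l$ of locations ($|U_l|=|S_l|$) with an initial location $\hat s_l$, a finite set of clocks, an invariant for each location (the invariant of $\hat s_l$ is $\top$), and finitely many edges $s\xrightarrow{g,r,\gamma}s'$. Invariants and clock guards $g$ are Boolean combinations of comparisons ($<,\le,>,\ge,=$) between two clocks or between a clock and a constant in $\mathbb Q_{\ge0}$; $r$ is a set of clocks to be reset. The guard $\gamma$ is conjunctive: it is given by sets $G_h\subseteq S_h$ with $\hat s_h\in G_h$ ($1\le h\le k$), and it holds for an instance $i$ of $U_l$ iff every other instance of $U_l$ is in a location of $G_l$ and, for each $h\ne l$, every instance of $U_h$ is in a location of $G_h$. \textbf{Network.} $(U_1,\dots,U_k)^{(n_1,\dots,n_k)}$ has $n_l$ instances of $U_l$. A configuration gives each instance a location and a nonnegative real value for each of its clocks, so that all invariants hold; initially all locations are initial and all clocks are $0$. A step is either a delay by some $d>0$ (all clocks increase by $d$ and all invariants hold throughout) or a synchronization, which takes no time: one instance follows one of its edges whose clock guard and conjunctive guard hold, and resets the clocks in $r$. A timed computation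 is a finite or infinite sequence $(\mathfrak c_0,t_0)(\mathfrak c_1,t_1)\dots$ of configurations and times, connected by steps, with $\mathfrak c_0$ initial and $t_0=0$. It is \emph{deadlocked} if it is finite and no step extends it. An infinite sequence is called an infinite timed computation if $t_v\to\infty$ or it contains infinitely many synchronizations (so cutting one bounded delay into infinitely many pieces does not count). The s-path $\rho$ of a timed computation is defined on $\bigcup_v[t_v,t_{v+1})$ (over all pairs of consecutive elements) and has at $t\in[t_v,t_{v+1})$ the value $\mathfrak c_v$ with all clocks advanced by $t-t_v$; computations in which no time passes have no s-path. \textbf{Formulae.} Let $L\subseteq\{1,\dots,k\}$, with one instance variable $i_l$ for each $l\in L$. An IMTL matrix $\Phi$ is built from $\top$ and the atoms $p(l,i_l)$ ($l\in L$, $p\in S_l$; true if instance $i_l$ of $U_l$ is in location $p$ in $\rho(0)$) with $\wedge$, $\neg$ and $\mathcal U_{\sim q}$ ($\sim\,\in\{<,\le,\ge,>,=\}$, $q\in\mathbb Q_{\ge0}$), where $\Phi_1\,\mathcal U_{\sim q}\,\Phi_2$ holds on $\rho$ iff for some $t'\sim q$ in the domain of $\rho$ the suffix of $\rho$ from $t'$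 satisfies $\Phi_2$ and for all $t\in[0,t')$ the suffix from $t$ satisfies $\Phi_1$. The quantifiers $A,E$ range over the s-paths of infinite and of deadlocked timed computations, $A_{\mathrm{inf}},E_{\mathrm{inf}}$ over those of infinite ones, and $A_{\mathrm{fin}},E_{\mathrm{fin}}$ over those of all finite ones. For $Q\in\{A,A_{\mathrm{inf}},A_{\mathrm{fin}},E,E_{\mathrm{inf}},E_{\mathrm{fin}}\}$ let $\phi=\bigwedge_{(i_l)_{l\in L}}Q\,\Phi$, where $i_l$ ranges over the $n_l$ instances of $U_l$. \textbf{Theorem (Conjunctive Cutoff Theorem).} In this setting, let $b\in\{0,1\}$ (for $b=1$ only networks with at least one instance of each template are considered, for $b=0$ all networks). Then $$(U_1,\dots,U_k)^{(n_1,\dots,n_k)}\models\phi\ \text{ for all natural numbers } n_1,\dots,n_k\ge b$$ if and only if $$(U_1,\dots,U_k)^{(d_1,\dots,d_k)}\models\phi\ \text{ for all natural numbers } d_1,\dots,d_k \text{ with } b\le d_l\le c_l \text{ for all } l,$$ where \begin{itemize} \item if $Q\in\{A_{\mathrm{inf}},E_{\mathrm{inf}}\}$, then $c_l=2$ for $l\in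 L$ and $c_l=1$ for $l\notin L$; \item if $Q\in\{A_{\mathrm{fin}},E_{\mathrm{fin}}\}$, then $c_l=1$ for all $l$; \item if $Q\in\{A,E\}$, then $c_l=2|U_l|+1$ for $l\in L$ and $c_l=2|U_l|$ for $l\notin L$. \end{itemize} -/

import Mathlib

open scoped NNReal

universe u v

/-- The five comparison symbols. -/
inductive Cmp where
  | lt | le | gt | ge | eq

/-- The relation denoted by a comparison symbol. -/
def Cmp.holds (r : Cmp) (a b : ℝ≥0) : Prop :=
  match r with
  | .lt => a < b
  | .le => a ≤ b
  | .gt => b < a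
  | .ge => b ≤ a
  | .eq => a = b

/-- Temporal constraints over a set `C` of clocks. -/
inductive ClockConstraint (C : Type v) where
  | top : ClockConstraint C
  | neg : ClockConstraint C → ClockConstraint C
  | or : ClockConstraint C → ClockConstraint C → ClockConstraint C
  | cmpClock : C → Cmp → C → ClockConstraint C
  | cmpConst : C → Cmp → ℚ≥0 → ClockConstraint C

/-- Satisfaction of a temporal constraint by a clock valuation. -/
def ClockConstraint.holds {C : Type v} (u : C → ℝ≥0) : ClockConstraint C → Prop
  | .top => True
  | .neg g => ¬ g.holds u
  | .or g g' => g.holds u ∨ g'.holds u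
  | .cmpClock c r c' => r.holds (u c) (u c')
  | .cmpConst c r q => r.holds (u c) (q : ℝ≥0)

/-- A conjunctive guard over the location sets `S h` with initial locations `init h`: for every
template `h` a set of locations (a disjunction) that contains the initial one. -/
structure ConjGuard {k : ℕ} (S : Fin k → Type u) (init : ∀ h, S h) where
  allowed : ∀ h, Set (S h)
  init_mem : ∀ h, init h ∈ allowed h

/-- A conjunctive guard of the instance `(l, i)`, evaluated in the locations `s` of all instances:
all *other* instances of template `l`, and all instances of the other templates, are in an
allowed location. -/
def ConjGuard.holds {k : ℕ} {S : Fin k → Type u} {init : ∀ h, S h} (γ : ConjGuard S init)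
    {n : Fin k → ℕ} (s : ∀ h, Fin (n h) → S h) (l : Fin k) (i : Fin (n l)) : Prop :=
  (∀ m : Fin (n l), m ≠ i → s l m ∈ γ.allowed l) ∧
    ∀ h, h ≠ l → ∀ j : Fin (n h), s h j ∈ γ.allowed h

/-- An edge of a template with locations `Loc`, clocks `C` and Boolean guards `G`. -/
structure TAEdge (Loc : Type u) (C : Type v) (G : Type u) where
  source : Loc
  clockGuard : ClockConstraint C
  reset : Set C
  guard : G
  target : Loc

/-- The `l`-th template of a family of `k` timed-automaton templates with conjunctive guards whose
location sets are `S` and whose initial locations are `init`. -/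
structure TATemplate {k : ℕ} (S : Fin k → Type u) (init : ∀ h, S h) (l : Fin k) where
  Clock : Type v
  clock_finite : Finite Clock
  guards : Set (ConjGuard S init)
  guards_finite : guards.Finite
  edges : Set (TAEdge (S l) Clock (ConjGuard S init))
  edges_finite : edges.Finite
  edges_guard : ∀ e ∈ edges, e.guard ∈ guards
  inv : S l → ClockConstraint Clock
  inv_init : inv (init l) = ClockConstraint.top

section Network

variable {k : ℕ} {S : Fin k → Type u} {init : ∀ h, S h}

/-- Configurations of the network with `n l` instances of the template `U l`. -/
structure Config (U : ∀ l, TATemplate.{u, v} S init l) (n : Fin k → ℕ) where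
  state : ∀ l, Fin (n l) → S l
  clock : ∀ l, Fin (n l) → (U l).Clock → ℝ≥0
  inv_holds : ∀ l i, ((U l).inv (state l i)).holds (clock l i)

variable {U : ∀ l, TATemplate.{u, v} S init l} {n : Fin k → ℕ}

/-- All instances are in their initial location and all clocks are zero. -/
def Config.IsInitial (c : Config U n) : Prop :=
  (∀ l i, c.state l i = init l) ∧ ∀ l i a, c.clock l i a = 0

/-- `c'` is `c` with all clocks advanced by `d`. -/
def Config.IsAdvance (c : Config U n) (d : ℝ≥0) (c' : Config U n) : Prop :=
  c'.state = c.state ∧ ∀ l i a, c'.clock l i a = c.clock l i a + d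

/-- The delay transition of duration `d`. -/
def Config.Delay (c : Config U n) (d : ℝ≥0) (c' : Config U n) : Prop :=
  c.IsAdvance d c' ∧
    ∀ l i, ∀ d' ≤ d, ((U l).inv (c.state l i)).holds (fun a => c.clock l i a + d')

open Classical in
/-- The synchronization transition: exactly one instance follows one of its edges. The invariant of
the target location holds because `c'` is a configuration. -/
def Config.Sync (c c' : Config U n) : Prop :=
  ∃ (l : Fin k) (i : Fin (n l)), ∃ e ∈ (U l).edges,
    c.state l i = e.source ∧
    e.clockGuard.holds (c.clock l i) ∧
    e.guard.holds c.state l i ∧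
    c'.state l i = e.target ∧
    (∀ a, c'.clock l i a = if a ∈ e.reset then 0 else c.clock l i a) ∧
    (∀ j, j ≠ i → c'.state l j = c.state l j ∧ c'.clock l j = c.clock l j) ∧
    ∀ h, h ≠ l → c'.state h = c.state h ∧ c'.clock h = c.clock h

/-- A step between two consecutive elements of a timed computation. -/
def TimedStep (c : Config U n) (t : ℝ≥0) (c' : Config U n) (t' : ℝ≥0) : Prop :=
  (∃ d : ℝ≥0, 0 < d ∧ c.Delay d c' ∧ t' = t + d) ∨ (c.Sync c' ∧ t' = t)

variable (U n) in
/-- A finite or infinite timed computation with `len` steps, i.e. the sequence of the pairs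
`(conf v, time v)` with `v ≤ len`. The values of `conf` and `time` beyond `len` play no role. -/
structure TimedComputation where
  len : ℕ∞
  conf : ℕ → Config U n
  time : ℕ → ℝ≥0
  conf_zero : (conf 0).IsInitial
  time_zero : time 0 = 0
  step : ∀ v : ℕ, (v : ℕ∞) < len → TimedStep (conf v) (time v) (conf (v + 1)) (time (v + 1))

/-- Finite timed computations. -/
def TimedComputation.IsFinite (x : TimedComputation U n) : Prop := x.len ≠ ⊤

/-- Deadlocked timed computations: finite ones that no step extends. -/
def TimedComputation.IsDeadlocked (x : TimedComputation U n) : Prop :=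
  ∃ N : ℕ, x.len = N ∧ ¬ ∃ c' t', TimedStep (x.conf N) (x.time N) c' t'

/-- Infinite timed computations. An infinite sequence that from some point on only cuts one bounded
delay into infinitely many pieces is not counted: time diverges, or there are infinitely many
synchronizations (a step is a synchronization iff it takes no time). -/
def TimedComputation.IsInfinite (x : TimedComputation U n) : Prop :=
  x.len = ⊤ ∧ ((∀ T : ℝ≥0, ∃ v, T < x.time v) ∨ ∀ w, ∃ v, w ≤ v ∧ x.time (v + 1) = x.time v)

/-- `ρ` is the s-path of the computation `x`: at a time `t` in `[time v, time (v + 1))` its value is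
`conf v` advanced by `t - time v`, and it has no other values. So its domain is the interval from
`0` (included) to the supremum of the times of `x` (excluded). It must have a first configuration. -/
def IsSPathOf (x : TimedComputation U n) (ρ : ℝ≥0 →. Config U n) : Prop :=
  (∀ t c, c ∈ ρ t ↔ ∃ v : ℕ, (v : ℕ∞) < x.len ∧ x.time v ≤ t ∧ t < x.time (v + 1) ∧
    (x.conf v).IsAdvance (t - x.time v) c) ∧ (ρ 0).Dom

end Network

/-- IMTL matrices `Φ((i_l)_{l ∈ L})`, with one instance variable `i_l` for every `l ∈ L`;
`atom l hl p` is the atomic proposition `p(l, i_l)`. -/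
inductive IMTL {k : ℕ} (S : Fin k → Type u) (L : Finset (Fin k)) : Type u where
  | top : IMTL S L
  | atom (l : Fin k) (hl : l ∈ L) (p : S l) : IMTL S L
  | and : IMTL S L → IMTL S L → IMTL S L
  | neg : IMTL S L → IMTL S L
  | until : IMTL S L → Cmp → ℚ≥0 → IMTL S L → IMTL S L

section Semantics

variable {k : ℕ} {S : Fin k → Type u} {init : ∀ h, S h}

/-- Satisfaction of an IMTL matrix on an s-path, where `idx l hl` is the value of `i_l`. The path
`fun s => ρ (t + s)` is the suffix of `ρ` from time `t` on. -/
def IMTL.holds {U : ∀ l, TATemplate.{u, v} S init l} {n : Fin k → ℕ} {L : Finset (Fin k)}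
    (idx : ∀ l ∈ L, Fin (n l)) : IMTL S L → (ℝ≥0 →. Config U n) → Prop
  | .top, _ => True
  | .atom l hl p, ρ => ∃ c ∈ ρ 0, c.state l (idx l hl) = p
  | .and Φ Ψ, ρ => Φ.holds idx ρ ∧ Ψ.holds idx ρ
  | .neg Φ, ρ => ¬ Φ.holds idx ρ
  | .until Φ r q Ψ, ρ => ∃ t' : ℝ≥0, r.holds t' (q : ℝ≥0) ∧ (ρ t').Dom ∧
      Ψ.holds idx (fun s => ρ (t' + s)) ∧ ∀ t < t', Φ.holds idx (fun s => ρ (t + s))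

/-- Which paths a path quantifier ranges over: `full` for the infinite and the deadlocked ones,
`inf` for the infinite ones, `fin` for the finite ones. -/
inductive PathRange where
  | full | inf | fin

/-- `A .full`, `A .inf`, `A .fin` are `A`, `A_inf`, `A_fin`, and likewise for `E`. -/
inductive PathQuantifier where
  | A (r : PathRange)
  | E (r : PathRange)

/-- The range of a path quantifier. -/
def PathQuantifier.range : PathQuantifier → PathRange
  | .A r => r
  | .E r => r

/-- The timed computations in a path range. -/
def PathRange.mem {U : ∀ l, TATemplate.{u, v} S init l} {n : Fin k → ℕ} (r : PathRange)
    (x : TimedComputation U n) : Prop :=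
  match r with
  | .full => x.IsInfinite ∨ x.IsDeadlocked
  | .inf => x.IsInfinite
  | .fin => x.IsFinite

/-- The network with `n l` instances of each template `U l` satisfies, in its initial configuration,
the formula `⋀_{(i_l)_{l ∈ L}} Q Φ((i_l)_{l ∈ L})`, where `i_l` ranges over the instances of `U l`. -/
def Models (U : ∀ l, TATemplate.{u, v} S init l) (n : Fin k → ℕ) (L : Finset (Fin k))
    (Q : PathQuantifier) (Φ : IMTL S L) : Prop :=
  ∀ idx : ∀ l ∈ L, Fin (n l),
    match Q with
    | .A r => ∀ (x : TimedComputation U n) (ρ : ℝ≥0 →. Config U n),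
        r.mem x → IsSPathOf x ρ → Φ.holds idx ρ
    | .E r => ∃ (x : TimedComputation U n) (ρ : ℝ≥0 →. Config U n),
        r.mem x ∧ IsSPathOf x ρ ∧ Φ.holds idx ρ

/-- The cutoff `c_l`. -/
noncomputable def cutoff (S : Fin k → Type u) (L : Finset (Fin k)) (Q : PathQuantifier) (l : Fin k) : ℕ :=
  match Q.range with
  | .inf => if l ∈ L then 2 else 1
  | .fin => 1
  | .full => if l ∈ L then 2 * Nat.card (S l) + 1 else 2 * Nat.card (S l)

end Semantics

/-! ### Deleting instances and adding idle ones -/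

section Projection

variable {k : ℕ} {S : Fin k → Type u} {init : ∀ h, S h}
  {U : ∀ l, TATemplate.{u, v} S init l} {n d : Fin k → ℕ}

/-! Conjunctive guards only restrict the other instances and always allow initial locations. Hence a
step survives the deletion of instances other than the one that moves (`Config.SyncBy.restrict`),
and it survives the addition of instances that idle in their initial location, whose invariant is
trivial (`Config.SyncBy.extend`). Synchronizations of deleted instances become stuttering and are
cut out (`exists_destutter`). Since an s-path only records delays of positive length, it is merely
restricted (`TimedComputation.Projects.at_iff`), and a matrix about retained instances keeps its
truth value (`IMTL.holds_restrict`).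

For `A`, a computation of a large network is projected to the indexed instances and a few witnesses
that keep it in its range. Finite and time-divergent computations need no witness. If
synchronizations recur for ever, one instance makes infinitely many of them and is the only witness.
A deadlock needs an instance that blocks every delay, and up to two instances in each location: a
guard ignores the instance that moves, so a second one must testify that the location is occupied.
The blocking instance can be one of these two, which gives `2 * Nat.card (S l)`, and the indexed
instance adds one.

For `E`, a computation of a subnetwork containing the indexed instances is extended by idle ones. A
deadlock may then be broken by the new instances, but no time can pass any more; letting them
synchronize as long as possible gives an infinite or a deadlocked computation with the same
projected s-path. -/

theorem Config.ext_of_eq {c c' : Config U n} (hs : c.state = c'.state)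
    (hc : c.clock = c'.clock) : c = c' := by
  cases c; cases c'; cases hs; cases hc; rfl

theorem Config.IsAdvance.unique {c a b : Config U n} {t : ℝ≥0} (ha : c.IsAdvance t a)
    (hb : c.IsAdvance t b) : a = b :=
  Config.ext_of_eq (ha.1.trans hb.1.symm)
    (by funext l i x; rw [ha.2 l i x, hb.2 l i x])

/-- The instance `i` of template `l` follows one of its edges. -/
def Config.SyncBy (c c' : Config U n) (l : Fin k) (i : Fin (n l)) : Prop :=
  ∃ e ∈ (U l).edges,
    c.state l i = e.source ∧
    e.clockGuard.holds (c.clock l i) ∧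
    e.guard.holds c.state l i ∧
    c'.state l i = e.target ∧
    (∀ a, (a ∈ e.reset → c'.clock l i a = 0) ∧ (a ∉ e.reset → c'.clock l i a = c.clock l i a)) ∧
    (∀ j, j ≠ i → c'.state l j = c.state l j ∧ c'.clock l j = c.clock l j) ∧
    ∀ h, h ≠ l → c'.state h = c.state h ∧ c'.clock h = c.clock h

/-- Names the moving instance and replaces the classical `if` in the reset by two implications, so
that restriction and extension need no case distinction on it. -/
theorem Config.sync_iff {c c' : Config U n} : c.Sync c' ↔ ∃ l i, c.SyncBy c' l i := by
  have key : ∀ (p : Prop) [Decidable p] (x y : ℝ≥0),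
      x = (if p then 0 else y) ↔ (p → x = 0) ∧ (¬ p → x = y) := by
    intro p _ x y
    by_cases hp : p <;> simp [hp]
  unfold Config.Sync Config.SyncBy
  simp only [key]

/-- The configuration of the instances selected by `f`. -/
def Config.restrict (f : ∀ l, Fin (d l) ↪ Fin (n l)) (c : Config U n) : Config U d where
  state l i := c.state l (f l i)
  clock l i := c.clock l (f l i)
  inv_holds l i := c.inv_holds l (f l i)

/-- The configuration in which the instances outside the range of `f` are in their initial
location with all clocks equal to `t`. -/
noncomputable def Config.extend (f : ∀ l, Fin (d l) ↪ Fin (n l)) (c : Config U d) (t : ℝ≥0) :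
    Config U n where
  state l := Function.extend (f l) (c.state l) (fun _ => init l)
  clock l := Function.extend (f l) (c.clock l) (fun _ _ => t)
  inv_holds l i := by
    by_cases h : ∃ j, f l j = i
    · obtain ⟨j, rfl⟩ := h
      simpa only [(f l).injective.extend_apply] using c.inv_holds l j
    · simp only [Function.extend_apply' _ _ _ h, (U l).inv_init, ClockConstraint.holds]

variable {f : ∀ l, Fin (d l) ↪ Fin (n l)}

theorem Config.extend_state (c : Config U d) (t : ℝ≥0) (l j) :
    (c.extend f t).state l (f l j) = c.state l j :=
  (f l).injective.extend_apply (c.state l) (fun _ => init l) j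

theorem Config.extend_clock (c : Config U d) (t : ℝ≥0) (l j) :
    (c.extend f t).clock l (f l j) = c.clock l j :=
  (f l).injective.extend_apply (c.clock l) (fun _ _ => t) j

theorem Config.extend_state' (c : Config U d) (t : ℝ≥0) (l i) (h : ¬ ∃ j, f l j = i) :
    (c.extend f t).state l i = init l :=
  Function.extend_apply' (c.state l) (fun _ => init l) i h

theorem Config.extend_clock' (c : Config U d) (t : ℝ≥0) (l i) (h : ¬ ∃ j, f l j = i) :
    (c.extend f t).clock l i = fun _ => t :=
  Function.extend_apply' (c.clock l) (fun _ _ => t) i h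

theorem Config.restrict_extend (c : Config U d) (t : ℝ≥0) : (c.extend f t).restrict f = c :=
  Config.ext_of_eq (by funext l i; exact c.extend_state t l i)
    (by funext l i; exact c.extend_clock t l i)

theorem Config.IsInitial.restrict {c : Config U n} (h : c.IsInitial) :
    (c.restrict f).IsInitial :=
  ⟨fun l i => h.1 l (f l i), fun l i => h.2 l (f l i)⟩

theorem Config.IsInitial.extend {c : Config U d} (h : c.IsInitial) :
    (c.extend f 0).IsInitial := by
  refine ⟨fun l i => ?_, fun l i a => ?_⟩ <;> by_cases hi : ∃ j, f l j = i
  · obtain ⟨j, rfl⟩ := hi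
    rw [c.extend_state, h.1]
  · exact c.extend_state' 0 l i hi
  · obtain ⟨j, rfl⟩ := hi
    rw [c.extend_clock, h.2]
  · rw [c.extend_clock' 0 l i hi]

theorem Config.IsAdvance.restrict {c c' : Config U n} {t : ℝ≥0} (h : c.IsAdvance t c') :
    (c.restrict f).IsAdvance t (c'.restrict f) :=
  ⟨by funext l i; exact congrFun (congrFun h.1 l) (f l i), fun l i => h.2 l (f l i)⟩

theorem Config.Delay.restrict {c c' : Config U n} {t : ℝ≥0} (h : c.Delay t c') :
    (c.restrict f).Delay t (c'.restrict f) :=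
  ⟨h.1.restrict, fun l i => h.2 l (f l i)⟩

theorem Config.Delay.extend {c c' : Config U d} {s : ℝ≥0} (h : c.Delay s c') (t : ℝ≥0) :
    (c.extend f t).Delay s (c'.extend f (t + s)) := by
  refine ⟨⟨?_, fun l i a => ?_⟩, fun l i s' hs' => ?_⟩
  · funext l i
    by_cases hi : ∃ j, f l j = i
    · obtain ⟨j, rfl⟩ := hi
      rw [extend_state, extend_state, h.1.1]
    · rw [extend_state' _ _ _ _ hi, extend_state' _ _ _ _ hi]
  · by_cases hi : ∃ j, f l j = i
    · obtain ⟨j, rfl⟩ := hi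
      rw [extend_clock, extend_clock, h.1.2]
    · rw [extend_clock' _ _ _ _ hi, extend_clock' _ _ _ _ hi]
  · by_cases hi : ∃ j, f l j = i
    · obtain ⟨j, rfl⟩ := hi
      rw [extend_clock, extend_state]
      exact h.2 l j s' hs'
    · rw [extend_state' _ _ _ _ hi, (U l).inv_init]
      trivial

theorem ConjGuard.holds.restrict {γ : ConjGuard S init} {s : ∀ h, Fin (n h) → S h} {l : Fin k}
    {i : Fin (d l)} (h : γ.holds s l (f l i)) : γ.holds (fun h j => s h (f h j)) l i :=
  ⟨fun _ hm => h.1 _ ((f l).injective.ne hm), fun h' hh j => h.2 h' hh (f h' j)⟩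

theorem Config.SyncBy.restrict {c c' : Config U n} {l : Fin k} {i : Fin (d l)}
    (h : c.SyncBy c' l (f l i)) : (c.restrict f).SyncBy (c'.restrict f) l i := by
  obtain ⟨e, he, h1, h2, h3, h4, h5, h6, h7⟩ := h
  refine ⟨e, he, h1, h2, h3.restrict, h4, h5,
    fun j hj => h6 _ ((f l).injective.ne hj), fun h hh => ⟨?_, ?_⟩⟩
  · funext j; exact congrFun (h7 h hh).1 (f h j)
  · funext j; exact congrFun (h7 h hh).2 (f h j)

theorem Config.SyncBy.restrict_eq {c c' : Config U n} {l : Fin k} {i : Fin (n l)}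
    (h : c.SyncBy c' l i) (hi : ¬ ∃ j, f l j = i) : c'.restrict f = c.restrict f := by
  obtain ⟨e, he, h1, h2, h3, h4, h5, h6, h7⟩ := h
  have key : ∀ h j, c'.state h (f h j) = c.state h (f h j) ∧
      c'.clock h (f h j) = c.clock h (f h j) := by
    intro h j
    by_cases hh : h = l
    · subst hh
      exact h6 _ fun hj => hi ⟨j, hj⟩
    · exact ⟨congrFun (h7 h hh).1 _, congrFun (h7 h hh).2 _⟩
  exact Config.ext_of_eq (by funext h j; exact (key h j).1) (by funext h j; exact (key h j).2)

theorem Config.SyncBy.extend {c c' : Config U d} {l : Fin k} {i : Fin (d l)}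
    (h : c.SyncBy c' l i) (t : ℝ≥0) : (c.extend f t).SyncBy (c'.extend f t) l (f l i) := by
  obtain ⟨e, he, h1, h2, h3, h4, h5, h6, h7⟩ := h
  refine ⟨e, he, ?_, ?_, ⟨fun m hm => ?_, fun h hh m => ?_⟩, ?_, ?_, fun m hm => ?_,
    fun h hh => ?_⟩
  · rwa [extend_state]
  · rwa [extend_clock]
  · by_cases hi : ∃ j, f l j = m
    · obtain ⟨j, rfl⟩ := hi
      rw [extend_state]
      exact h3.1 j fun hj => hm (hj ▸ rfl)
    · rw [extend_state' _ _ _ _ hi]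
      exact e.guard.init_mem l
  · by_cases hi : ∃ j, f h j = m
    · obtain ⟨j, rfl⟩ := hi
      rw [extend_state]
      exact h3.2 h hh j
    · rw [extend_state' _ _ _ _ hi]
      exact e.guard.init_mem h
  · rwa [extend_state]
  · rwa [extend_clock, extend_clock]
  · by_cases hi : ∃ j, f l j = m
    · obtain ⟨j, rfl⟩ := hi
      rw [extend_state, extend_state, extend_clock, extend_clock]
      exact h6 j fun hj => hm (hj ▸ rfl)
    · simp only [extend_state' _ _ _ _ hi, extend_clock' _ _ _ _ hi, and_self]
  · simp only [Config.extend, (h7 h hh).1, (h7 h hh).2, and_self]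

theorem TimedStep.extend {c c' : Config U d} {t t' : ℝ≥0} (h : TimedStep c t c' t') :
    TimedStep (c.extend f t) t (c'.extend f t') t' := by
  rcases h with ⟨s, hs, h, rfl⟩ | ⟨h, rfl⟩
  · exact .inl ⟨s, hs, h.extend t, rfl⟩
  · obtain ⟨l, i, h⟩ := Config.sync_iff.1 h
    exact .inr ⟨Config.sync_iff.2 ⟨l, f l i, h.extend _⟩, rfl⟩

/-- A delay concerns all instances and always survives; only a synchronization of a deleted instance
degenerates, and it takes no time. -/
theorem TimedStep.restrict {c c' : Config U n} {t t' : ℝ≥0} (h : TimedStep c t c' t')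
    (f : ∀ l, Fin (d l) ↪ Fin (n l)) :
    TimedStep (c.restrict f) t (c'.restrict f) t' ∨ c'.restrict f = c.restrict f ∧ t' = t := by
  rcases h with ⟨s, hs, h, rfl⟩ | ⟨h, rfl⟩
  · exact .inl (.inl ⟨s, hs, h.restrict, rfl⟩)
  · obtain ⟨l, i, h⟩ := Config.sync_iff.1 h
    by_cases hi : ∃ j, f l j = i
    · obtain ⟨j, rfl⟩ := hi
      exact .inl (.inr ⟨Config.sync_iff.2 ⟨l, j, h.restrict⟩, rfl⟩)
    · exact .inr ⟨h.restrict_eq hi, rfl⟩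

theorem TimedStep.le {c c' : Config U n} {t t' : ℝ≥0} (h : TimedStep c t c' t') : t ≤ t' := by
  rcases h with ⟨s, hs, h, rfl⟩ | ⟨h, rfl⟩
  · exact le_self_add
  · exact le_rfl

theorem TimedStep.delay_of_lt {c c' : Config U n} {t t' : ℝ≥0} (h : TimedStep c t c' t')
    (ht : t < t') : ∃ s, 0 < s ∧ c.Delay s c' ∧ t' = t + s := by
  rcases h with h | ⟨h, rfl⟩
  · exact h
  · exact absurd ht (lt_irrefl _)

theorem TimedStep.sync_of_eq {c c' : Config U n} {t t' : ℝ≥0} (h : TimedStep c t c' t')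
    (ht : t' = t) : c.Sync c' := by
  rcases h with ⟨s, hs, _, rfl⟩ | h
  · exact absurd ht (by simpa using hs.ne')
  · exact h.1

theorem Config.exists_isAdvance {c : Config U n} {s : ℝ≥0}
    (h : ∀ l i, ((U l).inv (c.state l i)).holds (fun a => c.clock l i a + s)) :
    ∃ c', c.IsAdvance s c' :=
  ⟨⟨c.state, fun l i a => c.clock l i a + s, h⟩, rfl, fun _ _ _ => rfl⟩

/-- The configuration `c` is taken at time `t` on the s-path of `x`. -/
def TimedComputation.At (x : TimedComputation U n) (t : ℝ≥0) (c : Config U n) : Prop :=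
  ∃ v : ℕ, (v : ℕ∞) < x.len ∧ x.time v ≤ t ∧ t < x.time (v + 1) ∧
    (x.conf v).IsAdvance (t - x.time v) c

theorem TimedComputation.exists_advance (x : TimedComputation U n) {v : ℕ} (hv : (v : ℕ∞) < x.len)
    {t : ℝ≥0} (h1 : x.time v ≤ t) (h2 : t < x.time (v + 1)) :
    ∃ c, (x.conf v).IsAdvance (t - x.time v) c := by
  obtain ⟨s, hs, hd, he⟩ := (x.step v hv).delay_of_lt (h1.trans_lt h2)
  refine Config.exists_isAdvance fun l i => hd.2 l i _ ?_
  rw [tsub_le_iff_left, ← he]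
  exact h2.le

theorem TimedComputation.time_le (x : TimedComputation U n) {v w : ℕ} (h : v ≤ w)
    (hw : (w : ℕ∞) ≤ x.len) : x.time v ≤ x.time w := by
  induction w, h using Nat.le_induction with
  | base => exact le_rfl
  | succ w _ ih =>
    have hw' : (w : ℕ∞) < x.len := lt_of_lt_of_le (by exact_mod_cast Nat.lt_succ_self w) hw
    exact (ih hw'.le).trans (x.step w hw').le

/-- Times are monotone, so the half-open intervals of different indices are disjoint. -/
theorem TimedComputation.At.unique {x : TimedComputation U n} {t : ℝ≥0} {a b : Config U n}
    (ha : x.At t a) (hb : x.At t b) : a = b := by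
  obtain ⟨v, hv, hv1, hv2, ha⟩ := ha
  obtain ⟨w, hw, hw1, hw2, hb⟩ := hb
  obtain rfl : v = w := by
    rcases lt_trichotomy v w with h | h | h
    · exact absurd (hv2.trans_le ((x.time_le h hw.le).trans hw1)) (lt_irrefl _)
    · exact h
    · exact absurd (hw2.trans_le ((x.time_le h hv.le).trans hv1)) (lt_irrefl _)
  exact ha.unique hb

theorem TimedComputation.exists_sPath (x : TimedComputation U n) {c : Config U n}
    (h : x.At 0 c) : ∃ ρ, IsSPathOf x ρ := by
  refine ⟨fun t => ⟨∃ c, x.At t c, fun h => h.choose⟩, fun t c => ?_, ⟨c, h⟩⟩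
  constructor
  · rintro ⟨h, rfl⟩
    exact h.choose_spec
  · intro h
    exact ⟨⟨c, h⟩, TimedComputation.At.unique (Exists.choose_spec (⟨c, h⟩ : ∃ c, x.At t c)) h⟩

/-- The delays of `y` are those of `x`, seen from the instances selected by `f`. -/
structure TimedComputation.Projects (f : ∀ l, Fin (d l) ↪ Fin (n l)) (x : TimedComputation U n)
    (y : TimedComputation U d) : Prop where
  down : ∀ w : ℕ, (w : ℕ∞) < x.len → x.time w < x.time (w + 1) →
    ∃ v : ℕ, (v : ℕ∞) < y.len ∧ y.time v = x.time w ∧ y.time (v + 1) = x.time (w + 1) ∧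
      y.conf v = (x.conf w).restrict f
  up : ∀ v : ℕ, (v : ℕ∞) < y.len → y.time v < y.time (v + 1) →
    ∃ w : ℕ, (w : ℕ∞) < x.len ∧ y.time v = x.time w ∧ y.time (v + 1) = x.time (w + 1) ∧
      y.conf v = (x.conf w).restrict f

/-- A step contributes to the s-path only if its half-open interval is nonempty, and exactly these
steps are matched by `Projects`. -/
theorem TimedComputation.Projects.at_iff {x : TimedComputation U n} {y : TimedComputation U d}
    (h : x.Projects f y) (t : ℝ≥0) (c' : Config U d) :
    y.At t c' ↔ ∃ c, x.At t c ∧ c.restrict f = c' := by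
  constructor
  · rintro ⟨v, hv, h1, h2, hc⟩
    obtain ⟨w, hw, e1, e2, e3⟩ := h.up v hv (h1.trans_lt h2)
    rw [e1] at h1 hc
    rw [e2] at h2
    rw [e3] at hc
    obtain ⟨c, hc'⟩ := x.exists_advance hw h1 h2
    exact ⟨c, ⟨w, hw, h1, h2, hc'⟩, hc'.restrict.unique hc⟩
  · rintro ⟨c, ⟨w, hw, h1, h2, hc⟩, rfl⟩
    obtain ⟨v, hv, e1, e2, e3⟩ := h.down w hw (h1.trans_lt h2)
    refine ⟨v, hv, e1 ▸ h1, e2 ▸ h2, ?_⟩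
    rw [e1, e3]
    exact hc.restrict

theorem TimedComputation.Projects.sPath {x : TimedComputation U n} {y : TimedComputation U d}
    (h : x.Projects f y) {ρ : ℝ≥0 →. Config U n} (hρ : IsSPathOf x ρ) :
    IsSPathOf y (fun t => (ρ t).map (Config.restrict f)) := by
  refine ⟨fun t c => ?_, hρ.2⟩
  refine Iff.trans ?_ (h.at_iff t c).symm
  rw [Part.mem_map_iff]
  exact exists_congr fun a => and_congr (hρ.1 t a) Iff.rfl

theorem TimedComputation.Projects.exists_sPath {x : TimedComputation U n}
    {y : TimedComputation U d} (h : x.Projects f y) {σ : ℝ≥0 →. Config U d}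
    (hσ : IsSPathOf y σ) :
    ∃ ρ, IsSPathOf x ρ ∧ σ = fun t => (ρ t).map (Config.restrict f) := by
  obtain ⟨c', hc'⟩ := Part.dom_iff_mem.1 hσ.2
  obtain ⟨c, hc, -⟩ := (h.at_iff 0 c').1 ((hσ.1 0 c').1 hc')
  obtain ⟨ρ, hρ⟩ := x.exists_sPath hc
  refine ⟨ρ, hρ, ?_⟩
  funext t
  ext a
  exact (hσ.1 t a).trans ((h.sPath hρ).1 t a).symm

/-- Atoms look only at selected instances, and `Part.map` leaves the domain unchanged, so `until`
ranges over the same times. -/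
theorem IMTL.holds_restrict {L : Finset (Fin k)} (idx : ∀ l ∈ L, Fin (d l)) (Φ : IMTL S L)
    (ρ : ℝ≥0 →. Config U n) :
    Φ.holds idx (fun t => (ρ t).map (Config.restrict f)) ↔
      Φ.holds (fun l hl => f l (idx l hl)) ρ := by
  match Φ with
  | .top => exact Iff.rfl
  | .atom l hl p =>
    simp only [IMTL.holds, Part.mem_map_iff]
    constructor
    · rintro ⟨_, ⟨c, hc, rfl⟩, h⟩
      exact ⟨c, hc, h⟩
    · rintro ⟨c, hc, h⟩
      exact ⟨_, ⟨c, hc, rfl⟩, h⟩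
  | .and Φ Ψ => exact and_congr (IMTL.holds_restrict idx Φ ρ) (IMTL.holds_restrict idx Ψ ρ)
  | .neg Φ => exact not_congr (IMTL.holds_restrict idx Φ ρ)
  | .until Φ r q Ψ =>
    refine exists_congr fun t' => and_congr Iff.rfl (and_congr Iff.rfl
      (and_congr (IMTL.holds_restrict idx Ψ _) ?_))
    exact forall_congr' fun t => imp_congr Iff.rfl (IMTL.holds_restrict idx Φ _)

end Projection

/-! ### Removal of stuttering steps -/

section Destutter

open Classical in
/-- Removal of the stuttering steps of a sequence. -/
theorem exists_destutter {α : Type*} (R : α → α → Prop) (z : ℕ → α) (len : ℕ∞)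
    (h : ∀ v : ℕ, (v : ℕ∞) < len → R (z v) (z (v + 1)) ∨ z (v + 1) = z v) :
    ∃ (z' : ℕ → α) (len' : ℕ∞) (g : ℕ → ℕ), z' 0 = z 0 ∧
      (∀ v : ℕ, (v : ℕ∞) < len' → ∃ w : ℕ, (w : ℕ∞) < len ∧ R (z w) (z (w + 1)) ∧
        z' v = z w ∧ z' (v + 1) = z (w + 1)) ∧
      (∀ w : ℕ, (w : ℕ∞) < len → R (z w) (z (w + 1)) →
        (g w : ℕ∞) < len' ∧ z' (g w) = z w ∧ z' (g w + 1) = z (w + 1)) ∧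
      Set.InjOn g {w | (w : ℕ∞) < len ∧ R (z w) (z (w + 1))} ∧
      ({w : ℕ | (w : ℕ∞) < len ∧ R (z w) (z (w + 1))}.Infinite → len' = ⊤) ∧
      ∀ N : ℕ, len = N → ∃ M : ℕ, len' = M ∧ z' M = z N := by
  -- A step counts as genuine if `R` holds, even when it does not change `z`: a self-loop
  -- synchronization must not be lost.
  set p : ℕ → Prop := fun w => (w : ℕ∞) < len ∧ R (z w) (z (w + 1)) with hp
  have const : ∀ a b : ℕ, a ≤ b → (b : ℕ∞) ≤ len → (∀ w, a ≤ w → w < b → ¬ p w) → z a = z b := by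
    intro a b hab
    induction b, hab using Nat.le_induction with
    | base => intros; rfl
    | succ b hab ih =>
      intro hb hw
      have hb' : (b : ℕ∞) < len := lt_of_lt_of_le (by exact_mod_cast Nat.lt_succ_self b) hb
      rw [ih hb'.le fun w h1 h2 => hw w h1 (h2.trans (Nat.lt_succ_self b))]
      rcases h b hb' with h | h
      · exact absurd ⟨hb', h⟩ (hw b hab (Nat.lt_succ_self b))
      · exact h.symm
  -- Position `j + 1` of the new sequence is read off just after the `j`-th genuine step; up to the
  -- next genuine step `z` is constant.
  let e : ℕ → ℕ := fun j => Nat.casesOn j 0 fun i => Nat.nth p i + 1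
  let len' : ℕ∞ := (Set.ofPred p).encard
  have hlt : ∀ j : ℕ, (j : ℕ∞) < len' ↔ ∀ hf : (Set.ofPred p).Finite, j < hf.toFinset.card := by
    intro j
    by_cases hf : (Set.ofPred p).Finite
    · simp only [len', hf.encard_eq_coe_toFinset_card, Nat.cast_lt, hf, forall_true_left]
    · simp only [len', Set.Infinite.encard_eq hf, hf, IsEmpty.forall_iff, iff_true]
      exact ENat.natCast_lt_top j
  have before : ∀ (j w : ℕ), (∀ i < j, (i : ℕ∞) < len') → p w → Nat.count p w < j → w < e j := by
    intro j w hj hw hc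
    obtain ⟨i, rfl⟩ : ∃ i, j = i + 1 := ⟨j - 1, by omega⟩
    have := Nat.nth_le_nth' (p := p) (Nat.lt_succ_iff.1 hc) ((hlt i).1 (hj i (Nat.lt_succ_self i)))
    rw [Nat.nth_count hw] at this
    exact Nat.lt_succ_of_le this
  have hmem : ∀ j : ℕ, (j : ℕ∞) < len' → p (Nat.nth p j) := fun j hj =>
    Nat.nth_mem j ((hlt j).1 hj)
  have hz : ∀ j : ℕ, (j : ℕ∞) < len' → z (e j) = z (Nat.nth p j) := by
    intro j hj
    have hlt' : ∀ i < j, (i : ℕ∞) < len' := fun i hi =>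
      lt_trans (by exact_mod_cast hi) hj
    refine const _ _ ?_ (hmem j hj).1.le ?_
    · cases j with
      | zero => exact Nat.zero_le _
      | succ i => exact Nat.nth_lt_nth' (Nat.lt_succ_self i) ((hlt _).1 hj)
    · intro w h1 h2 hw
      refine absurd (before j w hlt' hw ?_) (not_lt.2 h1)
      by_contra hc
      have := Nat.nth_le_nth' (p := p) (not_lt.1 hc) fun hf => Nat.count_lt_card hf hw
      rw [Nat.nth_count hw] at this
      exact absurd h2 (not_lt.2 this)
  have hcount : ∀ w, p w → (Nat.count p w : ℕ∞) < len' := fun w hw =>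
    (hlt _).2 fun hf => Nat.count_lt_card hf hw
  refine ⟨fun j => z (e j), len', Nat.count p, rfl, fun j hj => ?_, fun w hw hR => ?_, ?_, ?_, ?_⟩
  · exact ⟨Nat.nth p j, (hmem j hj).1, (hmem j hj).2, hz j hj, rfl⟩
  · have hw : p w := ⟨hw, hR⟩
    refine ⟨hcount w hw, ?_, ?_⟩
    · simp only [hz _ (hcount w hw), Nat.nth_count hw]
    · simp only [e, Nat.nth_count hw]
  · intro a ha b hb hab
    exact Nat.count_injective ha hb hab
  · intro hi
    exact hi.encard_eq
  · intro N hN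
    have hfin : (Set.ofPred p).Finite := (Set.finite_lt_nat N).subset fun w hw => by
      have := hw.1
      rw [hN] at this
      exact_mod_cast this
    have hM : len' = hfin.toFinset.card := hfin.encard_eq_coe_toFinset_card
    refine ⟨hfin.toFinset.card, hM, ?_⟩
    have hltM : ∀ i < hfin.toFinset.card, (i : ℕ∞) < len' := fun i hi => by
      rw [hM]
      exact_mod_cast hi
    refine const _ _ ?_ hN.ge ?_
    · cases hc : hfin.toFinset.card with
      | zero => exact Nat.zero_le _
      | succ i =>
        have := (hmem i (hltM i (by omega))).1
        rw [hN] at this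
        exact Nat.succ_le_of_lt (by exact_mod_cast this)
    · intro w h1 h2 hw
      exact absurd (before _ w hltM hw (Nat.count_lt_card hfin hw)) (not_lt.2 h1)

end Destutter

/-! ### Transfer of computations between networks -/

section Transfer

variable {k : ℕ} {S : Fin k → Type u} {init : ∀ h, S h}
  {U : ∀ l, TATemplate.{u, v} S init l} {n d : Fin k → ℕ} {f : ∀ l, Fin (d l) ↪ Fin (n l)}

/-- Destuttering is applied to pairs of configuration and time. The map `g` locates the surviving
steps; its injectivity carries infinitely many of them to unboundedly late positions. -/
theorem TimedComputation.exists_restrict (x : TimedComputation U n)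
    (f : ∀ l, Fin (d l) ↪ Fin (n l)) :
    ∃ (y : TimedComputation U d) (g : ℕ → ℕ), x.Projects f y ∧
      (∀ w : ℕ, (w : ℕ∞) < x.len →
        TimedStep ((x.conf w).restrict f) (x.time w) ((x.conf (w + 1)).restrict f)
          (x.time (w + 1)) →
        y.time (g w) = x.time w ∧ y.time (g w + 1) = x.time (w + 1)) ∧
      Set.InjOn g {w | (w : ℕ∞) < x.len ∧
        TimedStep ((x.conf w).restrict f) (x.time w) ((x.conf (w + 1)).restrict f)
          (x.time (w + 1))} ∧
      ({w : ℕ | (w : ℕ∞) < x.len ∧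
        TimedStep ((x.conf w).restrict f) (x.time w) ((x.conf (w + 1)).restrict f)
          (x.time (w + 1))}.Infinite → y.len = ⊤) ∧
      ∀ N : ℕ, x.len = N → ∃ M : ℕ, y.len = M ∧ y.conf M = (x.conf N).restrict f := by
  obtain ⟨z, len, g, h0, h1, h2, h3, h4, h5⟩ := exists_destutter
    (fun a b : Config U d × ℝ≥0 => TimedStep a.1 a.2 b.1 b.2)
    (fun v => ((x.conf v).restrict f, x.time v)) x.len
    (fun v hv => ((x.step v hv).restrict f).imp_right fun h => Prod.ext h.1 h.2)
  refine ⟨⟨len, fun v => (z v).1, fun v => (z v).2, ?_, ?_, fun v hv => ?_⟩, g,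
    ⟨fun w hw ht => ?_, fun v hv ht => ?_⟩, fun w hw hR => ?_, h3, h4, fun N hN => ?_⟩
  · rw [h0]
    exact x.conf_zero.restrict
  · rw [h0]
    exact x.time_zero
  · obtain ⟨w, hw, hR, e1, e2⟩ := h1 v hv
    rw [e1, e2]
    exact hR
  · have hR : TimedStep ((x.conf w).restrict f) (x.time w) ((x.conf (w + 1)).restrict f)
        (x.time (w + 1)) :=
      ((x.step w hw).restrict f).resolve_right fun h => ht.ne' h.2
    obtain ⟨hg, e1, e2⟩ := h2 w hw hR
    exact ⟨g w, hg, congrArg Prod.snd e1, congrArg Prod.snd e2, congrArg Prod.fst e1⟩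
  · obtain ⟨w, hw, hR, e1, e2⟩ := h1 v hv
    exact ⟨w, hw, congrArg Prod.snd e1, congrArg Prod.snd e2, congrArg Prod.fst e1⟩
  · obtain ⟨hg, e1, e2⟩ := h2 w hw hR
    exact ⟨congrArg Prod.snd e1, congrArg Prod.snd e2⟩
  · obtain ⟨M, hM, e⟩ := h5 N hN
    exact ⟨M, hM, congrArg Prod.fst e⟩

theorem exists_ge_of_infinite {g : ℕ → ℕ} {s : Set ℕ} (hs : s.Infinite) (hg : Set.InjOn g s)
    (m : ℕ) : ∃ w ∈ s, m ≤ g w := by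
  obtain ⟨_, ⟨w, hw, rfl⟩, h⟩ := (hs.image hg).exists_gt m
  exact ⟨w, hw, h.le⟩

theorem infinite_of_forall_exists_ge {s : Set ℕ} (h : ∀ m, ∃ w, m ≤ w ∧ w ∈ s) : s.Infinite :=
  Set.infinite_of_forall_exists_gt fun m => by
    obtain ⟨w, h1, h2⟩ := h (m + 1)
    exact ⟨w, h2, h1⟩

theorem TimedComputation.exists_restrict_of_diverges (x : TimedComputation U n) (hx : x.len = ⊤)
    (hT : ∀ T : ℝ≥0, ∃ v, T < x.time v) (f : ∀ l, Fin (d l) ↪ Fin (n l)) :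
    ∃ y : TimedComputation U d, x.Projects f y ∧ y.IsInfinite := by
  obtain ⟨y, g, hp, hg, hinj, htop, -⟩ := x.exists_restrict f
  have hlt : ∀ w : ℕ, (w : ℕ∞) < x.len := fun w => hx ▸ ENat.natCast_lt_top w
  -- Time diverges, so it increases at arbitrarily late steps, and such steps are never stuttering.
  have hinf : ∀ m, ∃ w, m ≤ w ∧ x.time w < x.time (w + 1) := by
    intro m
    by_contra! hc
    obtain ⟨v, hv⟩ := hT (x.time m)
    have hconst : ∀ w, m ≤ w → x.time w ≤ x.time m := by
      intro w hw
      induction w, hw using Nat.le_induction with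
      | base => exact le_rfl
      | succ w hw ih => exact (hc w hw).trans ih
    rcases le_total m v with h | h
    · exact absurd hv (not_lt.2 (hconst v h))
    · exact absurd hv (not_lt.2 (x.time_le h (hlt m).le))
  have hstep : ∀ w, x.time w < x.time (w + 1) →
      TimedStep ((x.conf w).restrict f) (x.time w) ((x.conf (w + 1)).restrict f)
        (x.time (w + 1)) := fun w hw =>
    ((x.step w (hlt w)).restrict f).resolve_right fun h => hw.ne' h.2
  refine ⟨y, hp, htop (infinite_of_forall_exists_ge fun m => ?_), Or.inl fun T => ?_⟩
  · obtain ⟨w, h1, h2⟩ := hinf m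
    exact ⟨w, h1, hlt w, hstep w h2⟩
  · obtain ⟨v, hv⟩ := hT T
    obtain ⟨w, h1, h2⟩ := hinf v
    refine ⟨g w, ?_⟩
    rw [(hg w (hlt w) (hstep w h2)).1]
    exact hv.trans_le (x.time_le h1 (hlt w).le)

theorem TimedComputation.exists_restrict_of_sync (x : TimedComputation U n) (hx : x.len = ⊤)
    (f : ∀ l, Fin (d l) ↪ Fin (n l)) {l : Fin k} {j : Fin (d l)}
    (h : ∀ w, ∃ v, w ≤ v ∧ x.time (v + 1) = x.time v ∧
      (x.conf v).SyncBy (x.conf (v + 1)) l (f l j)) :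
    ∃ y : TimedComputation U d, x.Projects f y ∧ y.IsInfinite := by
  obtain ⟨y, g, hp, hg, hinj, htop, -⟩ := x.exists_restrict f
  have hlt : ∀ w : ℕ, (w : ℕ∞) < x.len := fun w => hx ▸ ENat.natCast_lt_top w
  set s : Set ℕ := {w | (w : ℕ∞) < x.len ∧
    TimedStep ((x.conf w).restrict f) (x.time w) ((x.conf (w + 1)).restrict f) (x.time (w + 1))}
  have hinf : (s ∩ {w | x.time (w + 1) = x.time w}).Infinite :=
    infinite_of_forall_exists_ge fun m => by
      obtain ⟨w, h1, h2, h3⟩ := h m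
      exact ⟨w, h1, ⟨hlt w, Or.inr ⟨Config.sync_iff.2 ⟨l, j, h3.restrict⟩, h2⟩⟩, h2⟩
  refine ⟨y, hp, htop (hinf.mono Set.inter_subset_left), Or.inr fun m => ?_⟩
  obtain ⟨w, ⟨hw, ht⟩, hm⟩ := exists_ge_of_infinite hinf (hinj.mono Set.inter_subset_left) m
  obtain ⟨e1, e2⟩ := hg w hw.1 hw.2
  exact ⟨g w, hm, by rw [e1, e2]; exact ht⟩

/-- In an infinite computation time diverges, or some instance synchronizes infinitely often. -/
theorem TimedComputation.IsInfinite.diverges_or_sync {x : TimedComputation U n}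
    (hx : x.IsInfinite) : (∀ T : ℝ≥0, ∃ v, T < x.time v) ∨
      ∃ l i, ∀ w, ∃ v, w ≤ v ∧ x.time (v + 1) = x.time v ∧
        (x.conf v).SyncBy (x.conf (v + 1)) l i := by
  refine hx.2.imp_right fun h => ?_
  by_contra! hc
  choose W hW using hc
  -- There are finitely many instances, so the times after which each one stops synchronizing have a
  -- common bound.
  obtain ⟨M, hM⟩ : ∃ M, ∀ l i, W l i ≤ M := by
    obtain ⟨M, hM⟩ := Finite.bddAbove_range (fun q : Σ l, Fin (n l) => W q.1 q.2)
    exact ⟨M, fun l i => hM ⟨⟨l, i⟩, rfl⟩⟩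
  obtain ⟨v, hv, ht⟩ := h M
  obtain ⟨l, i, hs⟩ := Config.sync_iff.1
    ((x.step v (hx.1 ▸ ENat.natCast_lt_top v)).sync_of_eq ht)
  exact hW l i v ((hM l i).trans hv) ht hs

theorem TimedComputation.exists_extend (y : TimedComputation U d)
    (f : ∀ l, Fin (d l) ↪ Fin (n l)) :
    ∃ x : TimedComputation U n, x.Projects f y ∧ x.len = y.len ∧ x.time = y.time :=
  ⟨⟨y.len, fun v => (y.conf v).extend f (y.time v), y.time,
    by rw [y.time_zero]; exact y.conf_zero.extend, y.time_zero,
    fun v hv => (y.step v hv).extend⟩,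
    ⟨fun w hw _ => ⟨w, hw, rfl, rfl, (Config.restrict_extend _ _).symm⟩,
      fun w hw _ => ⟨w, hw, rfl, rfl, (Config.restrict_extend _ _).symm⟩⟩, rfl, rfl⟩

/-- The appended synchronizations take no time, so they are invisible to `Projects`; time is frozen
at its value at `N`. -/
theorem TimedComputation.exists_extend_tail (y : TimedComputation U d)
    (f : ∀ l, Fin (d l) ↪ Fin (n l)) {N : ℕ} (hN : y.len = N) (B : ℕ → Config U n)
    (hB0 : B 0 = (y.conf N).extend f (y.time N)) (M : ℕ∞)
    (hB : ∀ j : ℕ, (j : ℕ∞) < M → (B j).Sync (B (j + 1))) :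
    ∃ x : TimedComputation U n, x.Projects f y ∧ x.len = N + M ∧
      ∀ j, x.conf (N + j) = B j ∧ x.time (N + j) = y.time N := by
  let conf : ℕ → Config U n := fun v =>
    if v < N then (y.conf v).extend f (y.time v) else B (v - N)
  have conf_le : ∀ v ≤ N, conf v = (y.conf v).extend f (y.time v) := by
    intro v hv
    rcases hv.lt_or_eq with h | rfl
    · exact if_pos h
    · simp only [conf, lt_irrefl, if_false, Nat.sub_self, hB0]
  have conf_add : ∀ j, conf (N + j) = B j := fun j => by
    simp only [conf, Nat.not_lt.2 (Nat.le_add_right N j), if_false, Nat.add_sub_cancel_left]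
  have hlt : ∀ v, v < N → (v : ℕ∞) < y.len := fun v hv => by
    rw [hN]
    exact_mod_cast hv
  refine ⟨⟨N + M, conf, fun v => y.time (min v N), ?_, ?_, fun v hv => ?_⟩,
    ⟨fun w hw ht => ?_, fun v hv ht => ?_⟩, rfl, fun j => ⟨conf_add j, ?_⟩⟩
  · rw [conf_le 0 (Nat.zero_le N), y.time_zero]
    exact y.conf_zero.extend
  · rw [Nat.zero_min, y.time_zero]
  · rcases lt_or_ge v N with h | h
    · rw [conf_le v h.le, conf_le (v + 1) h, min_eq_left h.le, min_eq_left (Nat.succ_le_of_lt h)]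
      exact (y.step v (hlt v h)).extend
    · obtain ⟨j, rfl⟩ := Nat.exists_eq_add_of_le h
      rw [conf_add, Nat.add_assoc, conf_add, min_eq_right (Nat.le_add_right _ _),
        min_eq_right (Nat.le_add_right _ _)]
      refine Or.inr ⟨hB j ?_, rfl⟩
      rw [Nat.cast_add] at hv
      exact lt_of_add_lt_add_left hv
  · rcases lt_or_ge w N with h | h
    · refine ⟨w, hlt w h, ?_, ?_, ?_⟩
      · simp only [min_eq_left h.le]
      · simp only [min_eq_left (Nat.succ_le_of_lt h)]
      · simp only [conf_le w h.le, Config.restrict_extend]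
    · simp only [min_eq_right h, min_eq_right (h.trans (Nat.le_succ w)), lt_irrefl] at ht
  · have h : v < N := by
      rw [hN] at hv
      exact_mod_cast hv
    refine ⟨v, lt_of_lt_of_le (by exact_mod_cast h) le_self_add, ?_, ?_, ?_⟩
    · simp only [min_eq_left h.le]
    · simp only [min_eq_left (Nat.succ_le_of_lt h)]
    · simp only [conf_le v h.le, Config.restrict_extend]
  · simp only [min_eq_right (Nat.le_add_right N j)]

/-- From every point a relation can be followed for ever or up to a point without successor. -/
theorem exists_maximal_chain {α : Type*} (R : α → α → Prop) (a : α) :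
    ∃ (B : ℕ → α) (M : ℕ∞), B 0 = a ∧ (∀ j : ℕ, (j : ℕ∞) < M → R (B j) (B (j + 1))) ∧
      ∀ m : ℕ, M = m → ¬ ∃ b, R (B m) b := by
  classical
  let g : α → α := fun a => if h : ∃ b, R a b then h.choose else a
  have hg : ∀ a, (∃ b, R a b) → R a (g a) := fun a h => by
    simp only [g, h, dif_pos]
    exact h.choose_spec
  let B : ℕ → α := fun j => g^[j] a
  have hB : ∀ j, (∃ b, R (B j) b) → R (B j) (B (j + 1)) := fun j h => by
    simp only [B, Function.iterate_succ_apply']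
    exact hg _ h
  by_cases h : ∃ m, ¬ ∃ b, R (B m) b
  · refine ⟨B, (Nat.find h : ℕ), rfl, fun j hj => hB j ?_, fun m hm => ?_⟩
    · exact not_not.1 (Nat.find_min h (by exact_mod_cast hj))
    · obtain rfl : Nat.find h = m := by exact_mod_cast hm
      exact Nat.find_spec h
  · push Not at h
    exact ⟨B, ⊤, rfl, fun j _ => hB j (h j), fun m hm => absurd hm (ENat.top_ne_natCast m)⟩

/-- A deadlocked computation extends to larger networks: the additional instances idle, and after
the deadlock of the others they synchronize as long as they can. -/
theorem TimedComputation.IsDeadlocked.exists_extend {y : TimedComputation U d}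
    (hy : y.IsDeadlocked) (f : ∀ l, Fin (d l) ↪ Fin (n l)) :
    ∃ x : TimedComputation U n, x.Projects f y ∧ (x.IsInfinite ∨ x.IsDeadlocked) := by
  obtain ⟨N, hN, hdead⟩ := hy
  obtain ⟨B, M, hB0, hB, hmax⟩ := exists_maximal_chain (Config.Sync (U := U) (n := n))
    ((y.conf N).extend f (y.time N))
  -- A step that the selected instances noticed would extend the deadlocked `y`. What remains is a
  -- synchronization of an additional instance, which leaves the selected ones in their deadlock.
  have hkey : ∀ c c' t', c.restrict f = y.conf N → TimedStep c (y.time N) c' t' →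
      c'.restrict f = y.conf N ∧ c.Sync c' := by
    intro c c' t' hc h
    rcases h.restrict f with h' | ⟨h1, h2⟩
    · exact absurd ⟨_, _, hc ▸ h'⟩ hdead
    · exact ⟨h1.trans hc, h.sync_of_eq h2⟩
  have hr : ∀ j : ℕ, (j : ℕ∞) ≤ M → (B j).restrict f = y.conf N := by
    intro j
    induction j with
    | zero => intro _; rw [hB0, Config.restrict_extend]
    | succ j ih =>
      intro hj
      have hj' : (j : ℕ∞) < M := lt_of_lt_of_le (by exact_mod_cast Nat.lt_succ_self j) hj
      exact (hkey _ _ _ (ih hj'.le) (Or.inr ⟨hB j hj', rfl⟩)).1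
  obtain ⟨x, hp, hlen, hx⟩ := y.exists_extend_tail f hN B hB0 M hB
  refine ⟨x, hp, ?_⟩
  induction M using ENat.recTopCoe with
  | top =>
    refine Or.inl ⟨by rw [hlen, add_top], Or.inr fun w => ⟨N + w, Nat.le_add_left _ _, ?_⟩⟩
    rw [Nat.add_assoc, (hx _).2, (hx _).2]
  | coe m =>
    refine Or.inr ⟨N + m, by rw [hlen, Nat.cast_add], ?_⟩
    rintro ⟨c', t', h⟩
    rw [(hx m).1, (hx m).2] at h
    exact hmax m rfl ⟨c', (hkey _ _ _ (hr m le_rfl) h).2⟩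

end Transfer

/-! ### Deadlocks in small subnetworks -/

section Deadlock

variable {k : ℕ} {S : Fin k → Type u} {init : ∀ h, S h}
  {U : ∀ l, TATemplate.{u, v} S init l} {n d : Fin k → ℕ} {f : ∀ l, Fin (d l) ↪ Fin (n l)}

/-- If no delay is possible, then some instance forbids every delay. -/
theorem Config.exists_blocking {c : Config U n} (h : ∀ s c', 0 < s → ¬ c.Delay s c') :
    ∃ l i, ∀ s : ℝ≥0, 0 < s →
      ∃ s' ≤ s, ¬ ((U l).inv (c.state l i)).holds (fun a => c.clock l i a + s') := by
  by_contra! hc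
  -- If each of the finitely many instances tolerates some positive delay, all tolerate every
  -- sufficiently small one.
  have key : ∀ᶠ s in nhdsWithin (0 : ℝ≥0) (Set.Ioi 0), ∀ q : Σ l, Fin (n l), ∀ s' ≤ s,
      ((U q.1).inv (c.state q.1 q.2)).holds (fun a => c.clock q.1 q.2 a + s') := by
    refine Filter.eventually_all.2 fun q => ?_
    obtain ⟨s, hs, h⟩ := hc q.1 q.2
    filter_upwards [mem_nhdsWithin_of_mem_nhds (Iio_mem_nhds hs)] with t ht s' hs'
    exact h s' (hs'.trans (le_of_lt ht))
  obtain ⟨s, hs, hpos⟩ := (key.and self_mem_nhdsWithin).exists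
  obtain ⟨c', hc'⟩ := Config.exists_isAdvance (c := c) (s := s) fun l i => hs ⟨l, i⟩ s le_rfl
  exact h s c' hpos ⟨hc', fun l i => hs ⟨l, i⟩⟩

/-- A synchronization of a selected instance is possible in the large network as soon as every
location is occupied by another selected instance, or by selected instances only. -/
theorem Config.SyncBy.exists_lift {c : Config U n} {c' : Config U d} {l : Fin k} {j : Fin (d l)}
    (h : (c.restrict f).SyncBy c' l j)
    (hf : ∀ l (i m : Fin (n l)), (¬ ∃ j, f l j = m) →
      ∃ j, f l j ≠ i ∧ c.state l (f l j) = c.state l m) :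
    ∃ c'', c.SyncBy c'' l (f l j) := by
  obtain ⟨e, he, h1, h2, h3, h4, h5, h6, h7⟩ := h
  refine ⟨⟨Function.update c.state l (Function.update (c.state l) (f l j) e.target),
    Function.update c.clock l (Function.update (c.clock l) (f l j) (c'.clock l j)),
    fun l' i' => ?_⟩, e, he, h1, h2, ⟨fun m hm => ?_, fun h hh m => ?_⟩, ?_, ?_, fun m hm => ?_,
    fun h hh => ?_⟩
  · by_cases hl : l' = l
    · subst hl
      rw [Function.update_self, Function.update_self]
      by_cases hi : i' = f l' j
      · subst hi
        rw [Function.update_self, Function.update_self, ← h4]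
        exact c'.inv_holds l' j
      · rw [Function.update_of_ne hi, Function.update_of_ne hi]
        exact c.inv_holds l' i'
    · rw [Function.update_of_ne hl, Function.update_of_ne hl]
      exact c.inv_holds l' i'
  · by_cases hi : ∃ j, f l j = m
    · obtain ⟨j', rfl⟩ := hi
      exact h3.1 j' fun hj => hm (hj ▸ rfl)
    -- The representative of `m` must differ from the moving instance, about which the guard says
    -- nothing.
    · obtain ⟨j', hj', hs⟩ := hf l (f l j) m hi
      rw [← hs]
      exact h3.1 j' fun hj => hj' (hj ▸ rfl)
  · by_cases hi : ∃ j, f h j = m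
    · obtain ⟨j', rfl⟩ := hi
      exact h3.2 h hh j'
    -- In another template nothing has to be avoided; the first `m` is a dummy.
    · obtain ⟨j', -, hs⟩ := hf h m m hi
      rw [← hs]
      exact h3.2 h hh j'
  · simp only [Function.update_self]
  · simp only [Function.update_self]
    exact h5
  · simp only [Function.update_self, Function.update_of_ne hm, and_self]
  · simp only [Function.update_of_ne hh, and_self]

/-- Two elements are taken from every fibre of `s`, or the whole fibre if it is smaller: after
excluding `i`, one is still left. As `E` has at most one element, it can be among the chosen ones at
no extra cost. -/
theorem exists_small_selection {ι σ : Type*} [Fintype ι] [Finite σ] (s : ι → σ) (E : Finset ι)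
    (hE : E.card ≤ 1) : ∃ D : Finset ι, E ⊆ D ∧ D.card ≤ 2 * Nat.card σ ∧
      ∀ i, ∀ m ∉ D, ∃ m' ∈ D, m' ≠ i ∧ s m' = s m := by
  classical
  have := Fintype.ofFinite σ
  have key : ∀ p : σ, ∃ D ⊆ Finset.univ.filter (fun i => s i = p),
      E.filter (fun i => s i = p) ⊆ D ∧ D.card ≤ 2 ∧
        (D.card = 2 ∨ D = Finset.univ.filter (fun i => s i = p)) := by
    intro p
    have hsub : E.filter (fun i => s i = p) ⊆ Finset.univ.filter (fun i => s i = p) :=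
      Finset.filter_subset_filter _ (Finset.subset_univ E)
    rcases le_total (Finset.univ.filter (fun i => s i = p)).card 2 with h | h
    · exact ⟨_, subset_rfl, hsub, h, Or.inr rfl⟩
    · obtain ⟨D, h1, h2, h3⟩ := Finset.exists_subsuperset_card_eq hsub
        ((Finset.card_filter_le _ _).trans (hE.trans one_le_two)) h
      exact ⟨D, h2, h1, h3.le, Or.inl h3⟩
  choose D h1 h2 h3 h4 using key
  refine ⟨Finset.univ.biUnion D, fun i hi => ?_, ?_, fun i m hm => ?_⟩
  · exact Finset.mem_biUnion.2 ⟨s i, Finset.mem_univ _,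
      h2 _ (Finset.mem_filter.2 ⟨hi, rfl⟩)⟩
  · calc (Finset.univ.biUnion D).card ≤ Finset.univ.card * 2 :=
          Finset.card_biUnion_le_card_mul _ _ _ fun p _ => h3 p
      _ = 2 * Nat.card σ := by rw [Finset.card_univ, Nat.card_eq_fintype_card, mul_comm]
  · have hm' : m ∉ D (s m) := fun h =>
      hm (Finset.mem_biUnion.2 ⟨s m, Finset.mem_univ _, h⟩)
    have hcard : (D (s m)).card = 2 := (h4 (s m)).resolve_right fun h =>
      hm' (h ▸ Finset.mem_filter.2 ⟨Finset.mem_univ _, rfl⟩)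
    obtain ⟨m', hm1, hm2⟩ := Finset.exists_mem_ne (by rw [hcard]; exact one_lt_two) i
    exact ⟨m', Finset.mem_biUnion.2 ⟨s m, Finset.mem_univ _, hm1⟩, hm2,
      (Finset.mem_filter.1 (h1 _ hm1)).2⟩

/-- A deadlock persists in small subnetworks. -/
theorem TimedComputation.IsDeadlocked.exists_selection [∀ l, Finite (S l)]
    {x : TimedComputation U n} (hx : x.IsDeadlocked) :
    ∃ D : ∀ l, Finset (Fin (n l)), (∀ l, (D l).card ≤ 2 * Nat.card (S l)) ∧
      ∀ (d : Fin k → ℕ) (f : ∀ l, Fin (d l) ↪ Fin (n l)), (∀ l, ∀ i ∈ D l, ∃ j, f l j = i) →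
        ∃ y : TimedComputation U d, x.Projects f y ∧ y.IsDeadlocked := by
  classical
  obtain ⟨N, hN, hdead⟩ := hx
  obtain ⟨l₀, i₀, hblock⟩ := Config.exists_blocking (c := x.conf N) fun s c' hs h =>
    hdead ⟨c', _, Or.inl ⟨s, hs, h, rfl⟩⟩
  -- The set to be kept is the blocking instance in its own template and empty in all others.
  have hE : ∀ l, (Finset.univ.filter fun i : Fin (n l) =>
      (⟨l, i⟩ : Σ l, Fin (n l)) = ⟨l₀, i₀⟩).card ≤ 1 := fun l => by
    refine Finset.card_le_one.2 fun a ha b hb => ?_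
    have h := (Finset.mem_filter.1 ha).2.trans (Finset.mem_filter.1 hb).2.symm
    simpa using h
  choose D h1 h2 h3 using fun l => exists_small_selection ((x.conf N).state l) _ (hE l)
  refine ⟨D, h2, fun d f hf => ?_⟩
  obtain ⟨y, g, hp, -, -, -, hy⟩ := x.exists_restrict f
  obtain ⟨M, hM, hc⟩ := hy N hN
  refine ⟨y, hp, M, hM, ?_⟩
  rw [hc]
  rintro ⟨c', t', ⟨s, hs, h, -⟩ | ⟨h, -⟩⟩
  · obtain ⟨j, rfl⟩ := hf l₀ i₀ (h1 l₀ (by simp))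
    obtain ⟨s', hs', hinv⟩ := hblock s hs
    exact hinv (h.2 l₀ j s' hs')
  · obtain ⟨l, j, h⟩ := Config.sync_iff.1 h
    obtain ⟨c'', h'⟩ := h.exists_lift fun l i m hm => by
      obtain ⟨m', hm1, hm2, hm3⟩ := h3 l i m fun h => hm (hf l m h)
      obtain ⟨j, rfl⟩ := hf l m' hm1
      exact ⟨j, hm2, hm3⟩
    exact hdead ⟨c'', _, Or.inr ⟨Config.sync_iff.2 ⟨l, _, h'⟩, rfl⟩⟩

end Deadlock

/-! ### Counting instances and the cutoff theorem -/

section Cutoff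

variable {k : ℕ} {S : Fin k → Type u} {init : ∀ h, S h}
  {U : ∀ l, TATemplate.{u, v} S init l} {n : Fin k → ℕ}

/-- The subnetwork consists of the witnesses `D` and the indexed instances. Where this is empty and
`b = 1`, an arbitrary instance is added. -/
theorem exists_embedding {L : Finset (Fin k)} (idx : ∀ l ∈ L, Fin (n l))
    (D : ∀ l, Finset (Fin (n l))) {c : Fin k → ℕ} {b : ℕ} (hb : b ≤ 1) (hn : ∀ l, b ≤ n l)
    (hc : ∀ l, 1 ≤ c l) (hL : ∀ l ∈ L, (D l).card + 1 ≤ c l) (hL' : ∀ l ∉ L, (D l).card ≤ c l) :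
    ∃ (d : Fin k → ℕ) (f : ∀ l, Fin (d l) ↪ Fin (n l)) (idx' : ∀ l ∈ L, Fin (d l)),
      (∀ l, b ≤ d l ∧ d l ≤ c l) ∧ (fun l hl => f l (idx' l hl)) = idx ∧
        ∀ l, ∀ i ∈ D l, ∃ j, f l j = i := by
  classical
  have key : ∀ l, ∃ K : Finset (Fin (n l)), (∀ hl : l ∈ L, idx l hl ∈ K) ∧ D l ⊆ K ∧
      b ≤ K.card ∧ K.card ≤ c l := by
    intro l
    by_cases hl : l ∈ L
    · exact ⟨insert (idx l hl) (D l), fun _ => Finset.mem_insert_self _ _,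
        Finset.subset_insert _ _,
        hb.trans (Finset.card_pos.2 (Finset.insert_nonempty _ _)),
        (Finset.card_insert_le _ _).trans (hL l hl)⟩
    · by_cases hK : b ≤ (D l).card
      · exact ⟨D l, fun h => absurd h hl, subset_rfl, hK, hL' l hl⟩
      · obtain rfl : b = 1 := by omega
        have hD : D l = ∅ := Finset.card_eq_zero.1 (by omega)
        refine ⟨{⟨0, hn l⟩}, fun h => absurd h hl, ?_, ?_, ?_⟩
        · rw [hD]
          exact Finset.empty_subset _
        · rw [Finset.card_singleton]
        · rw [Finset.card_singleton]
          exact hc l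
  choose K h1 h2 h3 h4 using key
  have hf : ∀ l, ∀ i ∈ K l, ∃ j, (K l).orderEmbOfFin rfl j = i := fun l i hi => by
    have : i ∈ Set.range ((K l).orderEmbOfFin rfl) := by
      rw [Finset.range_orderEmbOfFin]
      exact hi
    exact this
  choose idx' hidx using fun l (hl : l ∈ L) => hf l (idx l hl) (h1 l hl)
  exact ⟨fun l => (K l).card, fun l => ((K l).orderEmbOfFin rfl).toEmbedding, idx',
    fun l => ⟨h3 l, h4 l⟩, by funext l hl; exact hidx l hl, fun l i hi => hf l i (h2 l hi)⟩

theorem one_le_cutoff [∀ l, Finite (S l)] (init : ∀ h, S h) (L : Finset (Fin k))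
    (Q : PathQuantifier) (l : Fin k) : 1 ≤ cutoff S L Q l := by
  have : 0 < Nat.card (S l) := Nat.card_pos_iff.2 ⟨⟨init l⟩, inferInstance⟩
  unfold cutoff
  split <;> (try split) <;> omega

/-- Every computation in a path range is seen by its indexed instances in a network within the
cutoff. -/
theorem PathRange.mem.exists_restrict [∀ l, Finite (S l)] {L : Finset (Fin k)}
    {Q : PathQuantifier} {x : TimedComputation U n} (hx : Q.range.mem x)
    (idx : ∀ l ∈ L, Fin (n l)) {b : ℕ} (hb : b ≤ 1) (hn : ∀ l, b ≤ n l) :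
    ∃ (d : Fin k → ℕ) (f : ∀ l, Fin (d l) ↪ Fin (n l)) (idx' : ∀ l ∈ L, Fin (d l))
      (y : TimedComputation U d), (∀ l, b ≤ d l ∧ d l ≤ cutoff S L Q l) ∧
      (fun l hl => f l (idx' l hl)) = idx ∧ x.Projects f y ∧ Q.range.mem y := by
  classical
  have hc := one_le_cutoff init L Q
  -- Two instances suffice here, the indexed one and one that synchronizes infinitely often; this
  -- serves both `inf` and `full`.
  have hinf : x.IsInfinite → (∀ l ∈ L, 2 ≤ cutoff S L Q l) →
      ∃ (d : Fin k → ℕ) (f : ∀ l, Fin (d l) ↪ Fin (n l)) (idx' : ∀ l ∈ L, Fin (d l))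
      (y : TimedComputation U d), (∀ l, b ≤ d l ∧ d l ≤ cutoff S L Q l) ∧
      (fun l hl => f l (idx' l hl)) = idx ∧ x.Projects f y ∧ y.IsInfinite := by
    intro hx h2
    rcases hx.diverges_or_sync with hT | ⟨l₀, i₀, hs⟩
    · obtain ⟨d, f, idx', hd, hidx, -⟩ := exists_embedding idx (fun _ => ∅) hb hn hc
        (fun l _ => hc l) (fun l _ => Nat.zero_le _)
      obtain ⟨y, hy, hy'⟩ := x.exists_restrict_of_diverges hx.1 hT f
      exact ⟨d, f, idx', y, hd, hidx, hy, hy'⟩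
    · have hE : ∀ l, (Finset.univ.filter fun i : Fin (n l) =>
          (⟨l, i⟩ : Σ l, Fin (n l)) = ⟨l₀, i₀⟩).card ≤ 1 := fun l => by
        refine Finset.card_le_one.2 fun a ha b hb => ?_
        have h := (Finset.mem_filter.1 ha).2.trans (Finset.mem_filter.1 hb).2.symm
        simpa using h
      obtain ⟨d, f, idx', hd, hidx, hf⟩ := exists_embedding idx _ hb hn hc
        (fun l hl => (Nat.succ_le_succ (hE l)).trans (h2 l hl)) (fun l _ => (hE l).trans (hc l))
      obtain ⟨j, rfl⟩ := hf l₀ i₀ (by simp)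
      obtain ⟨y, hy, hy'⟩ := x.exists_restrict_of_sync hx.1 f hs
      exact ⟨d, f, idx', y, hd, hidx, hy, hy'⟩
  cases hr : Q.range with
  | inf =>
    rw [hr] at hx
    exact hinf hx fun l hl => by simp [cutoff, hr, hl]
  | fin =>
    rw [hr] at hx
    obtain ⟨d, f, idx', hd, hidx, -⟩ := exists_embedding idx (fun _ => ∅) hb hn hc
      (fun l _ => hc l) (fun l _ => Nat.zero_le _)
    obtain ⟨y, g, hy, -, -, -, hfin⟩ := x.exists_restrict f
    obtain ⟨N, hN⟩ := ENat.ne_top_iff_exists.1 hx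
    obtain ⟨M, hM, -⟩ := hfin N hN.symm
    refine ⟨d, f, idx', y, hd, hidx, hy, ?_⟩
    rw [PathRange.mem, TimedComputation.IsFinite, hM]
    exact ENat.natCast_ne_top M
  | full =>
    rw [hr] at hx
    have hcut : ∀ l, cutoff S L Q l =
        if l ∈ L then 2 * Nat.card (S l) + 1 else 2 * Nat.card (S l) := fun l => by
      simp only [cutoff, hr]
    rcases hx with hx | hx
    · obtain ⟨d, f, idx', y, hd, hidx, hy, hy'⟩ := hinf hx fun l hl => by
        have : 0 < Nat.card (S l) := Nat.card_pos_iff.2 ⟨⟨init l⟩, inferInstance⟩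
        rw [hcut, if_pos hl]
        omega
      exact ⟨d, f, idx', y, hd, hidx, hy, Or.inl hy'⟩
    · obtain ⟨D, hD, hsel⟩ := hx.exists_selection
      obtain ⟨d, f, idx', hd, hidx, hf⟩ := exists_embedding idx D hb hn hc
        (fun l hl => by rw [hcut, if_pos hl]; exact Nat.succ_le_succ (hD l))
        (fun l hl => by rw [hcut, if_neg hl]; exact hD l)
      obtain ⟨y, hy, hy'⟩ := hsel d f hf
      exact ⟨d, f, idx', y, hd, hidx, hy, Or.inr hy'⟩

/-- Every computation in a path range extends to larger networks. -/
theorem PathRange.mem.exists_extend {d : Fin k → ℕ} {r : PathRange} {y : TimedComputation U d}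
    (hy : r.mem y) (f : ∀ l, Fin (d l) ↪ Fin (n l)) :
    ∃ x : TimedComputation U n, x.Projects f y ∧ r.mem x := by
  obtain ⟨x, hp, hlen, htime⟩ := y.exists_extend f
  have hinf : y.IsInfinite → x.IsInfinite := fun h => by
    rw [TimedComputation.IsInfinite, hlen, htime]
    exact h
  cases r with
  | inf => exact ⟨x, hp, hinf hy⟩
  | fin =>
    refine ⟨x, hp, ?_⟩
    rw [PathRange.mem, TimedComputation.IsFinite, hlen]
    exact hy
  | full =>
    rcases hy with hy | hy
    · exact ⟨x, hp, Or.inl (hinf hy)⟩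
    · exact hy.exists_extend f

end Cutoff

theorem mainTheorem1 {k : ℕ} {S : Fin k → Type u} [∀ l, Finite (S l)] {init : ∀ l, S l}
    (U : ∀ l, TATemplate.{u, v} S init l) (L : Finset (Fin k)) (Q : PathQuantifier)
    (Φ : IMTL S L) (b : ℕ) (hb : b ≤ 1) :
    (∀ n : Fin k → ℕ, (∀ l, b ≤ n l) → Models U n L Q Φ) ↔
      (∀ d : Fin k → ℕ, (∀ l, b ≤ d l ∧ d l ≤ cutoff S L Q l) → Models U d L Q Φ) := by
  refine ⟨fun h d hd => h d fun l => (hd l).1, fun h n hn idx => ?_⟩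
  cases Q with
  | A r =>
    intro x ρ hx hρ
    obtain ⟨d, f, idx', y, hd, rfl, hp, hy⟩ :=
      PathRange.mem.exists_restrict (Q := .A r) hx idx hb hn
    exact (IMTL.holds_restrict idx' Φ ρ).1 (h d hd idx' y _ hy (hp.sPath hρ))
  | E r =>
    -- Extension works from any subnetwork with the indexed instances, so only the bound `1` is
    -- used.
    have hc := one_le_cutoff init L (.E r)
    obtain ⟨d, f, idx', hd, rfl, -⟩ := exists_embedding idx (fun _ => ∅) hb hn hc
      (fun l _ => hc l) (fun l _ => Nat.zero_le _)
    obtain ⟨y, σ, hy, hσ, hΦ⟩ := h d hd idx'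
    obtain ⟨x, hp, hx⟩ := PathRange.mem.exists_extend hy f
    obtain ⟨ρ, hρ, rfl⟩ := hp.exists_sPath hσ
    exact ⟨x, ρ, hx, hρ, (IMTL.holds_restrict idx' Φ ρ).1 hΦ⟩
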